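/- \textbf{Proposition.} Let $1\le\alpha<W$ be integers and let $w=(w[0],\dots,w[W-1])\in\mathbb{C}^W$ be a vector all of whose entries are non-zero. Let $Z\subset\mathbb{C}^W\times\mathbb{C}^W$ be the linear subspace of all pairs $(y_0,y_\alpha)$ such that $$w[j+\alpha]\,y_0[j]=w[j]\,y_\alpha[j+\alpha],\qquad j=0,\dots,W-1-\alpha .$$ For $y\in\mathbb{C}^W$ let $A_y(\omega)=\bigl|\sum_{n=0}^{W-1}y[n]\omega^n\bigr|^2$, for $\omega$ in the unit circle $S^1$, be its Fourier intensity function. Then a generic pair $(y_0,y_\alpha)\in Z$ is determined, up to a global phase, by $A_{y_0}$ and $A_{y_\alpha}$. Precisely: there is a real polynomial in the real and imaginary parts of the entries of a pair, not vanishing identically on $Z$, such that for every $(y_0,y_\alpha)\in Z$ at which it does not vanish the following holds: if $(y'_0,y'_\alpha)\in Z$ satisfies $A_{y_0}=A_{y'_0}$ and $A_{y_\alpha}=A_{y'_\alpha}$, then $(y'_0,y'_\alpha)=e^{\iota\theta}(y_0,y_\alpha)$ for some $\theta\in\mathbb{R}$. -/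

import Mathlib

/-!
Reconstruction is rigid at the point of `Z` with polynomials `1` and `c (X - 2) ^ α`. The Fourier
intensities of a pair fix the products of its polynomials with their conjugate reversals, which at
this point have only the roots `0`, `2` and `1/2`; the linear relations prescribe degrees and
leading coefficients, and this leaves only one way to distribute the roots over the factors.

If reconstruction failed generically, there would be counterexamples off the zero set of every
polynomial that does not vanish at the special point, and an ultrafilter turns them into a
counterexample over a field of germs in which these polynomials remain nonzero. A valuation ring of
this field then dominates the local ring of the special point. By Gauss's lemma the competing
factorization reduces, after rescaling, to one at the special point, where it is the known one; as
the two factors are coprime there, the factorization upstairs is the known one up to scalars too.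
Equality of intensities forces the remaining scalar to have modulus one.
-/

namespace PhaselessSTFT

noncomputable section

/-- The Fourier transform of `y ∈ ℂ^W` as a function on the unit circle:
`ŷ(ω) = y[0] + y[1] ω + ⋯ + y[W-1] ω^(W-1)`. -/
def fourier {W : ℕ} (y : Fin W → ℂ) (ω : Circle) : ℂ :=
  ∑ n : Fin W, y n * (ω : ℂ) ^ (n : ℕ)

/-- The Fourier intensity function `A_y(ω) = |ŷ(ω)|²` on the unit circle. -/
def fourierIntensity {W : ℕ} (y : Fin W → ℂ) : Circle → ℝ :=
  fun ω => ‖fourier y ω‖ ^ 2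

/-- The linear subspace of `ℂ^W × ℂ^W` of the pairs `(y₀, y_α)` with
`w[j+α] y₀[j] = w[j] y_α[j+α]` for `j = 0, …, W-1-α`. -/
def linearRelations {W : ℕ} (α : ℕ) (w : Fin W → ℂ) :
    Submodule ℂ ((Fin W → ℂ) × (Fin W → ℂ)) where
  carrier := {y | ∀ (j : ℕ) (h : j + α < W),
    w ⟨j + α, h⟩ * y.1 ⟨j, by omega⟩ = w ⟨j, by omega⟩ * y.2 ⟨j + α, h⟩}
  zero_mem' := by
    intro j h
    simp
  add_mem' := by
    intro a b ha hb j h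
    have h1 := ha j h
    have h2 := hb j h
    simp only [Prod.fst_add, Prod.snd_add, Pi.add_apply, mul_add, h1, h2]
  smul_mem' := by
    intro c a ha j h
    have h1 := ha j h
    simp only [Prod.smul_fst, Prod.smul_snd, Pi.smul_apply, smul_eq_mul]
    linear_combination c * h1

/-- The `4W` real coordinates of a pair of vectors in `ℂ^W`: the real parts of all entries,
then the imaginary parts of all entries. -/
def realCoords {W : ℕ} (y : (Fin W → ℂ) × (Fin W → ℂ)) :
    (Fin W ⊕ Fin W) ⊕ (Fin W ⊕ Fin W) → ℝ :=
  Sum.elim (fun i => (Sum.elim y.1 y.2 i).re) (fun i => (Sum.elim y.1 y.2 i).im)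

/-- `P` holds for a generic element of the linear subspace `Z`: the elements of `Z` for which `P`
fails all lie in the zero set of a real polynomial in the real and imaginary parts of the
entries that does not vanish identically on `Z`. -/
def GenericOn {W : ℕ} (Z : Submodule ℂ ((Fin W → ℂ) × (Fin W → ℂ)))
    (P : (Fin W → ℂ) × (Fin W → ℂ) → Prop) : Prop :=
  ∃ p : MvPolynomial ((Fin W ⊕ Fin W) ⊕ (Fin W ⊕ Fin W)) ℝ,
    (∃ z ∈ Z, MvPolynomial.eval (realCoords z) p ≠ 0) ∧
    ∀ z ∈ Z, MvPolynomial.eval (realCoords z) p ≠ 0 → P z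

end

end PhaselessSTFT

namespace PhaselessSTFT

open Polynomial IsLocalRing Filter
open scoped ComplexConjugate

section CoprimeFactors

theorem exists_eq_C_mul_of_mul_eq_mul {R : Type*} [CommRing R] [IsDomain R] {P Q p q : R[X]}
    (h : p * q = P * Q) (hPq : IsCoprime P q) (hq : q ≠ 0) (hQ : Q.natDegree ≤ q.natDegree) :
    ∃ γ : R, p = C γ * P := by
  obtain ⟨x, rfl⟩ : P ∣ p := hPq.dvd_of_dvd_mul_right ⟨Q, h⟩
  rcases eq_or_ne P 0 with rfl | hP
  · exact ⟨0, by simp⟩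
  have hxq : x * q = Q := mul_left_cancel₀ hP (by rw [← h, mul_assoc])
  have hx : x.natDegree = 0 := by
    rcases eq_or_ne x 0 with rfl | hx
    · exact natDegree_zero
    · rw [← hxq, natDegree_mul hx hq] at hQ
      omega
  exact ⟨x.coeff 0, by rw [← eq_C_of_natDegree_eq_zero hx, mul_comm]⟩

theorem isCoprime_of_monic_of_isCoprime_map_residue {R : Type*} [CommRing R] [IsLocalRing R]
    {f g : R[X]} (hf : f.Monic) (h : IsCoprime (f.map (residue R)) (g.map (residue R))) :
    IsCoprime f g := by
  rw [← isUnit_resultant_iff_isCoprime hf, ← residue_ne_zero_iff_isUnit, ← resultant_map_map,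
    ← hf.natDegree_map (residue R), ← Nat.add_sub_cancel' (natDegree_map_le (f := residue R)),
    resultant_add_right_deg _ _ _ _ _ le_rfl, (hf.map _).coeff_natDegree, one_pow, one_mul]
  exact resultant_ne_zero _ _ h

theorem isCoprime_of_isCoprime_map_residue {R : Type*} [CommRing R] [IsLocalRing R] {f g : R[X]}
    (hf : IsUnit f.leadingCoeff) (h : IsCoprime (f.map (residue R)) (g.map (residue R))) :
    IsCoprime f g := by
  obtain ⟨c, hc⟩ := hf.exists_left_inv
  have hu : IsUnit (C c) := isUnit_C.2 (isUnit_iff_exists_inv.2 ⟨_, hc⟩)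
  rw [← isCoprime_mul_unit_left_left hu]
  refine isCoprime_of_monic_of_isCoprime_map_residue (monic_C_mul_of_mul_leadingCoeff_eq_one hc) ?_
  rw [Polynomial.map_mul]
  exact (isCoprime_mul_unit_left_left (hu.map (mapRingHom (residue R))) _ _).2 h

end CoprimeFactors

section ValuationRing

variable {V K : Type*} [CommRing V] [IsDomain V] [ValuationRing V] [Field K] [Algebra V K]
  [IsFractionRing V K]

theorem exists_eq_mul_algebraMap {ι : Type*} {s : Finset ι} {x : ι → K}
    (hx : ∃ i ∈ s, x i ≠ 0) :
    ∃ (c : K) (y : ι → V), c ≠ 0 ∧ (∀ i ∈ s, x i = c * algebraMap V K (y i)) ∧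
      ∃ i ∈ s, y i = 1 := by
  obtain ⟨l, hls, hl⟩ := hx
  obtain ⟨m, hms, hmax⟩ := s.exists_max_image (fun i => ValuationRing.valuation V K (x i)) ⟨l, hls⟩
  have hm : x m ≠ 0 := by
    intro h0
    have := hmax l hls
    rw [h0, map_zero, le_zero_iff, Valuation.zero_iff] at this
    exact hl this
  have hint : ∀ i ∈ s, ∃ a : V, algebraMap V K a = x i / x m := by
    intro i hi
    rw [← ValuationRing.mem_integer_iff V K, Valuation.mem_integer_iff, map_div₀]
    exact div_le_one_of_le₀ (hmax i hi) zero_le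
  choose! y hy using hint
  refine ⟨x m, y, hm, fun i hi => by rw [hy i hi, mul_div_cancel₀ _ hm], m, hms, ?_⟩
  apply IsFractionRing.injective V K
  rw [hy m hms, div_self hm, map_one]

theorem exists_eq_C_mul_map_of_ne_zero {G : K[X]} (hG : G ≠ 0) :
    ∃ (c : K) (g : V[X]), c ≠ 0 ∧ G = C c * g.map (algebraMap V K) ∧
      g.map (residue V) ≠ 0 := by
  obtain ⟨n, hn⟩ := nonempty_support_iff.2 hG
  obtain ⟨c, y, hc, hy, m, hm, hym⟩ :=
    exists_eq_mul_algebraMap (V := V) (x := G.coeff) ⟨n, hn, mem_support_iff.1 hn⟩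
  refine ⟨c, ∑ i ∈ G.support, monomial i (y i), hc, ?_, fun h0 => ?_⟩
  · rw [Polynomial.map_sum, Finset.mul_sum]
    conv_lhs => rw [G.as_sum_support]
    exact Finset.sum_congr rfl fun i hi => by rw [map_monomial, C_mul_monomial, ← hy i hi]
  · have := congrArg (coeff · m) h0
    simp [coeff_monomial, hym, mem_support_iff.1 hm] at this

theorem exists_factorization_of_mul_eq_map {f : V[X]} (hf : f.map (residue V) ≠ 0) {G H : K[X]}
    (h : G * H = f.map (algebraMap V K)) :
    ∃ (c : K) (g q : V[X]), c ≠ 0 ∧ G = C c * g.map (algebraMap V K) ∧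
      H = C c⁻¹ * q.map (algebraMap V K) ∧ g * q = f := by
  have hinj : Function.Injective (algebraMap V K) := IsFractionRing.injective V K
  have hGH : G * H ≠ 0 := by
    rw [h, Polynomial.map_ne_zero_iff hinj]
    rintro rfl
    simp at hf
  obtain ⟨c, g, hc, hG, hg⟩ := exists_eq_C_mul_map_of_ne_zero (V := V) (left_ne_zero_of_mul hGH)
  obtain ⟨d, q, -, hH, hq⟩ := exists_eq_C_mul_map_of_ne_zero (V := V) (right_ne_zero_of_mul hGH)
  have hprod : f.map (algebraMap V K) = C (c * d) * (g * q).map (algebraMap V K) := by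
    rw [← h, hG, hH, Polynomial.map_mul, C_mul]
    ring
  obtain ⟨u, hu⟩ : ∃ u : V, algebraMap V K u = c * d := by
    have hgq : (g * q).map (residue V) ≠ 0 := by
      rw [Polynomial.map_mul]
      exact mul_ne_zero hg hq
    obtain ⟨m, hm⟩ := nonempty_support_iff.2 hgq
    rw [mem_support_iff, coeff_map, residue_ne_zero_iff_isUnit] at hm
    obtain ⟨e, he⟩ := hm.exists_right_inv
    refine ⟨f.coeff m * e, ?_⟩
    rw [map_mul, ← coeff_map, hprod, coeff_C_mul, coeff_map, mul_assoc, ← map_mul, he, map_one,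
      mul_one]
  refine ⟨c, g, C u * q, hc, hG, ?_, ?_⟩
  · rw [Polynomial.map_mul, map_C, hu, hH, ← mul_assoc, ← C_mul, inv_mul_cancel_left₀ hc]
  · apply Polynomial.map_injective _ hinj
    rw [hprod, ← hu, mul_left_comm, Polynomial.map_mul, map_C]

end ValuationRing

section Linked

/-- The pair `p 0, p 1` of polynomials satisfies the `α`-shifted linear relations with ratios
`r 0, r 1, …`: up to degree `N`, the coefficient of `p 1` at `j + α` is `r j` times the coefficient
of `p 0` at `j`. -/
def IsLinked {R : Type*} [Semiring R] (N α : ℕ) (r : ℕ → R) (p : Fin 2 → R[X]) : Prop :=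
  ∀ j, j + α ≤ N → (p 1).coeff (j + α) = r j * (p 0).coeff j

theorem IsLinked.map {R S : Type*} [Semiring R] [Semiring S] {N α : ℕ} {r : ℕ → R}
    {p : Fin 2 → R[X]} (h : IsLinked N α r p) (f : R →+* S) :
    IsLinked N α (f ∘ r) (fun i => (p i).map f) := fun j hj => by
  rw [coeff_map, coeff_map, h j hj, map_mul, Function.comp_apply]

theorem IsLinked.of_C_mul_map {R K : Type*} [CommRing R] [Field K] {f : R →+* K}
    (hf : Function.Injective f) {N α : ℕ} {r : ℕ → R} {p : Fin 2 → R[X]} {x : Fin 2 → K}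
    {d : K} (hd : d ≠ 0) {a : Fin 2 → R} (hx : ∀ i, x i = d * f (a i))
    (h : IsLinked N α (f ∘ r) (fun i => C (x i) * (p i).map f)) :
    IsLinked N α r (fun i => C (a i) * p i) := fun j hj => hf <| mul_left_cancel₀ hd <| by
  have hj' := h j hj
  simp only [coeff_C_mul, coeff_map, hx, Function.comp_apply] at hj'
  simp only [coeff_C_mul, map_mul]
  linear_combination hj'

end Linked

/-- Over the field `k`, the factorizations of the products `P i * Q i` by polynomials of degree at
most `N` are determined up to scalars, among those whose left factors are linked with ratios `r`
and whose reversed right factors are linked with ratios `s`. The relations are imposed up to a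
point `(a 0 : a 1)` of the projective line, which is what survives of the scalings of the factors
when a solution over a valued field is reduced. -/
def IsRigid {k : Type*} [Field k] (N α : ℕ) (r s : ℕ → k) (P Q : Fin 2 → k[X]) : Prop :=
  ∀ (a : Fin 2 → k) (p q : Fin 2 → k[X]), (∃ i, a i ≠ 0) →
    (∀ i, (p i).natDegree ≤ N) → (∀ i, (q i).natDegree ≤ N) → (∀ i, p i * q i = P i * Q i) →
    IsLinked N α r (fun i => C (a i) * p i) →
    IsLinked N α s (fun i => C (a i.rev) * (q i).reflect N) →
    ∀ i, ∃ c, c ≠ 0 ∧ p i = C c * P i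

section Lifting

variable {V K : Type*} [CommRing V] [IsDomain V] [ValuationRing V] [Field K] [Algebra V K]
  [IsFractionRing V K]

theorem exists_eq_C_mul_of_map_residue_eq {R : Type*} [CommRing R] [IsDomain R] [IsLocalRing R]
    {P Q p q : R[X]} {c : ResidueField R} (h : p * q = P * Q)
    (hqQ : q.natDegree ≤ Q.natDegree) (hQ : IsUnit Q.leadingCoeff)
    (hPQ : IsCoprime (P.map (residue R)) (Q.map (residue R)))
    (hP : P.map (residue R) ≠ 0) (hc : c ≠ 0)
    (hp : p.map (residue R) = C c * P.map (residue R)) :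
    ∃ γ : R, p = C γ * P := by
  have hQ' : Q.map (residue R) = C c * q.map (residue R) := by
    apply mul_left_cancel₀ hP
    rw [← Polynomial.map_mul, ← h, Polynomial.map_mul, hp]
    ring
  have hcu : IsUnit (C c) := isUnit_C.2 hc.isUnit
  have hcoeff : IsUnit (q.coeff Q.natDegree) := by
    rw [← residue_ne_zero_iff_isUnit, leadingCoeff, ← coeff_map, hQ', coeff_C_mul, coeff_map] at hQ
    exact (residue_ne_zero_iff_isUnit _).1 (right_ne_zero_of_mul hQ)
  have hdeg : q.natDegree = Q.natDegree := hqQ.antisymm (le_natDegree_of_ne_zero hcoeff.ne_zero)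
  rw [← hdeg] at hcoeff
  rw [hQ', isCoprime_mul_unit_left_right hcu] at hPQ
  exact exists_eq_C_mul_of_mul_eq_mul h (isCoprime_of_isCoprime_map_residue hcoeff hPQ.symm).symm
    (leadingCoeff_ne_zero.1 hcoeff.ne_zero) hdeg.ge

theorem inv_apply_eq_apply_rev_div {F : Type*} [Field F] {c : Fin 2 → F} (hc : ∀ i, c i ≠ 0) :
    ∀ i, (c i)⁻¹ = c i.rev / (c 0 * c 1) :=
  Fin.forall_fin_two.2
    ⟨(div_mul_cancel_right₀ (hc 1) _).symm, (div_mul_cancel_left₀ (hc 0) _).symm⟩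

theorem IsRigid.exists_eq_C_mul_map {N α : ℕ} {r s : ℕ → V} {P Q : Fin 2 → V[X]}
    (hrigid : IsRigid N α (residue V ∘ r) (residue V ∘ s) (fun i => (P i).map (residue V))
      (fun i => (Q i).map (residue V)))
    (hcop : ∀ i, IsCoprime ((P i).map (residue V)) ((Q i).map (residue V)))
    (hP : ∀ i, (P i).map (residue V) ≠ 0) (hQN : ∀ i, (Q i).natDegree = N)
    (hQ : ∀ i, IsUnit (Q i).leadingCoeff)
    {p q : Fin 2 → K[X]} (hpN : ∀ i, (p i).natDegree ≤ N) (hqN : ∀ i, (q i).natDegree ≤ N)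
    (hpq : ∀ i, p i * q i = (P i * Q i).map (algebraMap V K))
    (hp : IsLinked N α (algebraMap V K ∘ r) p)
    (hq : IsLinked N α (algebraMap V K ∘ s) (fun i => (q i).reflect N)) (i : Fin 2) :
    ∃ γ : K, p i = C γ * (P i).map (algebraMap V K) := by
  have hinj : Function.Injective (algebraMap V K) := IsFractionRing.injective V K
  have hPQ i : (P i * Q i).map (residue V) ≠ 0 := by
    rw [Polynomial.map_mul]
    refine mul_ne_zero (hP i) fun h0 => (residue_ne_zero_iff_isUnit _).2 (hQ i) ?_
    rw [leadingCoeff, ← coeff_map, h0, coeff_zero]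
  choose c g h hc hpg hqh hgh using fun i => exists_factorization_of_mul_eq_map (hPQ i) (hpq i)
  have hgN i : (g i).natDegree ≤ N := by
    rw [← natDegree_map_eq_of_injective hinj, ← natDegree_C_mul (hc i), ← hpg]
    exact hpN i
  have hhN i : (h i).natDegree ≤ N := by
    rw [← natDegree_map_eq_of_injective hinj, ← natDegree_C_mul (inv_ne_zero (hc i)), ← hqh]
    exact hqN i
  obtain ⟨d, a, hd, ha, m, -, ham⟩ :=
    exists_eq_mul_algebraMap (V := V) (s := Finset.univ) (x := c) ⟨0, Finset.mem_univ _, hc 0⟩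
  replace ha i := ha i (Finset.mem_univ i)
  have hg : IsLinked N α r (fun i => C (a i) * g i) :=
    .of_C_mul_map hinj hd ha (by simpa only [← hpg] using hp)
  have hh : IsLinked N α s (fun i => C (a i.rev) * (h i).reflect N) := by
    have hscale i : (c i)⁻¹ = d / (c 0 * c 1) * algebraMap V K (a i.rev) := by
      rw [inv_apply_eq_apply_rev_div hc, ha, div_mul_eq_mul_div]
    refine .of_C_mul_map hinj (div_ne_zero hd (mul_ne_zero (hc 0) (hc 1))) hscale ?_
    simpa only [← reflect_map, ← reflect_C_mul, ← hqh] using hq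
  obtain ⟨e, he, hge⟩ := hrigid (residue V ∘ a) (fun i => (g i).map (residue V))
    (fun i => (h i).map (residue V)) ⟨m, by simp [ham]⟩ (fun i => natDegree_map_le.trans (hgN i))
    (fun i => natDegree_map_le.trans (hhN i))
    (fun i => by rw [← Polynomial.map_mul, ← Polynomial.map_mul, hgh])
    (by simpa using hg.map (residue V)) (by simpa [reflect_map] using hh.map (residue V)) i
  obtain ⟨γ, hγ⟩ := exists_eq_C_mul_of_map_residue_eq (hgh i) ((hhN i).trans (hQN i).ge) (hQ i)
    (hcop i) (hP i) he hge
  exact ⟨c i * algebraMap V K γ, by rw [hpg, hγ, Polynomial.map_mul, map_C, C_mul, mul_assoc]⟩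

end Lifting

section Reflect

theorem reflect_X_sub_C_pow {R : Type*} [CommRing R] (a : R) (n : ℕ) :
    ((X - C a) ^ n).reflect n = (1 - C a * X) ^ n := by
  induction n with
  | zero => simp
  | succ n ih =>
    have h : (X - C a).reflect 1 = 1 - C a * X := by
      rw [reflect_sub, reflect_C, pow_one]
      congr 1
      exact reflect_one_X
    have hdeg : ((X - C a) ^ n).natDegree ≤ n := by
      simpa using natDegree_pow_le_of_le n (natDegree_X_sub_C_le a)
    rw [pow_succ, pow_succ, reflect_mul _ _ hdeg (natDegree_X_sub_C_le _), ih, h]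

variable {R : Type*} [Semiring R]

theorem reflect_X_pow_mul {n M : ℕ} {f : R[X]} (hf : f.natDegree ≤ M) :
    (X ^ n * f).reflect (n + M) = f.reflect M := by
  rw [reflect_mul _ _ (natDegree_X_pow_le n) hf]
  simp

theorem natDegree_reflect_eq {M : ℕ} {f : R[X]} (hf : f.natDegree ≤ M) (h0 : f.coeff 0 ≠ 0) :
    (f.reflect M).natDegree = M := by
  refine le_antisymm (natDegree_reflect_le.trans_eq (max_eq_left hf)) (le_natDegree_of_ne_zero ?_)
  simpa [coeff_reflect] using h0

end Reflect

section BasePoint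

variable {k : Type*} [Field k]

theorem exists_of_mul_eq_C_mul_X_pow_mul {κ : k} {a b : k} {E A B : ℕ} (hκ : κ ≠ 0) {p q : k[X]}
    (h : p * q = C κ * X ^ E * (X - C a) ^ A * (X - C b) ^ B) :
    ∃ (c c' : k) (e e' m m' n n' : ℕ), c * c' = κ ∧ e + e' = E ∧ m + m' = A ∧ n + n' = B ∧
      p = C c * (X ^ e * ((X - C a) ^ m * (X - C b) ^ n)) ∧
      q = C c' * (X ^ e' * ((X - C a) ^ m' * (X - C b) ^ n')) := by
  obtain ⟨n, n', y, z, hn, h, hp, hq⟩ := mul_eq_mul_prime_pow (prime_X_sub_C b) h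
  obtain ⟨m, m', y', z', hm, h, hy, hz⟩ := mul_eq_mul_prime_pow (prime_X_sub_C a) h.symm
  obtain ⟨e, e', u, v, he, h, hy', hz'⟩ := mul_eq_mul_prime_pow prime_X h.symm
  have huv : IsUnit (u * v) := h ▸ isUnit_C.2 hκ.isUnit
  obtain ⟨c, -, hc⟩ := Polynomial.isUnit_iff.1 (isUnit_of_mul_isUnit_left huv)
  obtain ⟨c', -, hc'⟩ := Polynomial.isUnit_iff.1 (isUnit_of_mul_isUnit_right huv)
  refine ⟨c, c', e, e', m, m', n, n', ?_, he, hm, hn, ?_, ?_⟩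
  · apply C_injective
    rw [C_mul, h, hc, hc']
  · rw [hp, hy, hy', hc, mul_assoc, mul_assoc]
  · rw [hq, hz, hz', hc', mul_assoc, mul_assoc]

section Monomial

variable {N α i : ℕ} {r : ℕ → k} {a : Fin 2 → k} {p : Fin 2 → k[X]} {x : k}

theorem IsLinked.natDegree_eq_and_leadingCoeff_eq (h : IsLinked N α r fun j => C (a j) * p j)
    (h0 : p 0 = C x * X ^ i) (h1 : p 1 ≠ 0) (ha : a 1 ≠ 0) (hα : α ≤ (p 1).natDegree)
    (hN : (p 1).natDegree ≤ N) :
    (p 1).natDegree = i + α ∧ a 1 * (p 1).leadingCoeff = r i * (a 0 * x) := by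
  have hlead := h ((p 1).natDegree - α) (by omega)
  simp only [Nat.sub_add_cancel hα, h0, coeff_C_mul, coeff_X_pow] at hlead
  split_ifs at hlead with hi
  · exact ⟨by omega, by rw [leadingCoeff, hlead, hi, mul_one]⟩
  · rw [mul_zero, mul_zero, mul_zero] at hlead
    exact absurd hlead (mul_ne_zero ha (leadingCoeff_ne_zero.2 h1))

theorem IsLinked.nextCoeff_eq_zero (h : IsLinked N α r fun j => C (a j) * p j)
    (h0 : p 0 = C x * X ^ i) (ha : a 1 ≠ 0) (hi : i ≠ 0) (hdeg : (p 1).natDegree = i + α)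
    (hN : (p 1).natDegree ≤ N) : (p 1).nextCoeff = 0 := by
  have hnext := h (i - 1) (by omega)
  simp only [h0, coeff_C_mul, coeff_X_pow, if_neg (show i - 1 ≠ i by omega), mul_zero, mul_eq_zero,
    ha, false_or] at hnext
  rwa [nextCoeff_of_natDegree_pos (by omega), hdeg, show i + α - 1 = i - 1 + α by omega]

theorem natDegree_eq_of_isLinked_of_isLinked {s : ℕ → k} (ha : ∃ j, a j ≠ 0)
    {q : Fin 2 → k[X]} (hx : x ≠ 0) (hp0 : p 0 = C x * X ^ i) (hq0 : q 0 = C x⁻¹ * X ^ i)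
    (hp1 : p 1 ≠ 0) (hq1 : q 1 ≠ 0) (hpα : α ≤ (p 1).natDegree) (hpN : (p 1).natDegree ≤ N)
    (hqα : α ≤ (q 1).natDegree) (hqN : (q 1).natDegree ≤ N)
    (hp : IsLinked N α r fun j => C (a j) * p j)
    (hq : IsLinked N α s fun j => C (a j.rev) * q j) :
    (p 1).natDegree = i + α ∧ (q 1).natDegree = i + α ∧
      (p 1).leadingCoeff * (q 1).leadingCoeff = r i * s i ∧ (i ≠ 0 → (p 1).nextCoeff = 0) := by
  have hp' ha1 := hp.natDegree_eq_and_leadingCoeff_eq hp0 hp1 ha1 hpα hpN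
  have hq' ha0 :=
    IsLinked.natDegree_eq_and_leadingCoeff_eq (a := a ∘ Fin.rev) hq hq0 hq1 ha0 hqα hqN
  have ha1 : a 1 ≠ 0 := by
    intro h1
    have h0 : a 0 ≠ 0 := by simpa [Fin.exists_fin_two, h1] using ha
    have hlead : a 0 * (q 1).leadingCoeff = s i * (a 1 * x⁻¹) := (hq' h0).2
    simp [h1, h0, hq1] at hlead
  obtain ⟨hpdeg, hplead⟩ := hp' ha1
  have ha0 : a 0 ≠ 0 := by
    intro h0
    simp [h0, ha1, hp1] at hplead
  obtain ⟨hqdeg, hqlead : a 0 * (q 1).leadingCoeff = s i * (a 1 * x⁻¹)⟩ := hq' ha0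
  refine ⟨hpdeg, hqdeg, ?_, fun hi => hp.nextCoeff_eq_zero hp0 ha1 hi hpdeg hpN⟩
  apply mul_left_cancel₀ (mul_ne_zero ha0 ha1)
  calc a 0 * a 1 * ((p 1).leadingCoeff * (q 1).leadingCoeff)
      = (a 1 * (p 1).leadingCoeff) * (a 0 * (q 1).leadingCoeff) := by ring
    _ = a 0 * a 1 * (r i * s i) * (x * x⁻¹) := by rw [hplead, hqlead]; ring
    _ = a 0 * a 1 * (r i * s i) := by rw [mul_inv_cancel₀ hx, mul_one]

end Monomial

theorem natDegree_C_mul_X_pow_mul_X_sub_C_pow {c : k} (hc : c ≠ 0) (a b : k) (e m n : ℕ) :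
    (C c * (X ^ e * ((X - C a) ^ m * (X - C b) ^ n))).natDegree = e + (m + n) := by
  rw [natDegree_C_mul hc, (monic_X_pow e).natDegree_mul
    (((monic_X_sub_C a).pow m).mul ((monic_X_sub_C b).pow n)),
    ((monic_X_sub_C a).pow m).natDegree_mul ((monic_X_sub_C b).pow n), natDegree_X_pow,
    natDegree_pow, natDegree_X_sub_C, natDegree_pow, natDegree_X_sub_C, mul_one, mul_one]

theorem nextCoeff_C_mul_X_pow_mul_X_sub_C_pow (c a b : k) (e m n : ℕ) :
    (C c * (X ^ e * ((X - C a) ^ m * (X - C b) ^ n))).nextCoeff = -c * (m * a + n * b) := by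
  have ha := (monic_X_sub_C a).pow m
  have hb := (monic_X_sub_C b).pow n
  rw [nextCoeff_C_mul, (monic_X_pow e).nextCoeff_mul (ha.mul hb), ha.nextCoeff_mul hb,
    monic_X.nextCoeff_pow, (monic_X_sub_C a).nextCoeff_pow, (monic_X_sub_C b).nextCoeff_pow,
    nextCoeff_X_sub_C, nextCoeff_X_sub_C, show (X : k[X]).nextCoeff = 0 by simp [nextCoeff],
    nsmul_zero, nsmul_eq_mul, nsmul_eq_mul]
  ring

theorem natDegree_and_leadingCoeff_reflect {a b c : k} (ha : a ≠ 0) (hb : b ≠ 0) (hc : c ≠ 0)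
    {e m n M : ℕ} (hM : m + n ≤ M) {p : k[X]}
    (hp : p = C c * (X ^ e * ((X - C a) ^ m * (X - C b) ^ n))) :
    (p.reflect (e + M)).natDegree = M ∧
      (p.reflect (e + M)).leadingCoeff = c * ((-a) ^ m * (-b) ^ n) := by
  have hdeg : (C c * ((X - C a) ^ m * (X - C b) ^ n)).natDegree ≤ M := by
    simpa using (natDegree_C_mul_X_pow_mul_X_sub_C_pow hc a b 0 m n).trans_le (by omega)
  have h0 : (C c * ((X - C a) ^ m * (X - C b) ^ n)).coeff 0 = c * ((-a) ^ m * (-b) ^ n) := by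
    simp [coeff_zero_eq_eval_zero]
  rw [hp, mul_left_comm, reflect_X_pow_mul hdeg]
  have hM' := natDegree_reflect_eq hdeg (h0 ▸ mul_ne_zero hc
    (mul_ne_zero (pow_ne_zero _ (neg_ne_zero.2 ha)) (pow_ne_zero _ (neg_ne_zero.2 hb))))
  refine ⟨hM', ?_⟩
  rw [leadingCoeff, hM', coeff_reflect, revAt_le le_rfl, Nat.sub_self, h0]

/-- The polynomials of the pair `(y₀, y_α)` with `y₀ = (1, 0, …, 0)` and `y_α` the coefficients of
`c (X - 2) ^ α`, the point of `Z` at which the reconstruction is rigid. -/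
noncomputable def basePoint {R : Type*} [CommRing R] (α : ℕ) (c : R) : Fin 2 → R[X] :=
  ![1, C c * (X - C 2) ^ α]

theorem basePoint_one_reflect {N α : ℕ} (hαN : α ≤ N) (c : k) :
    (basePoint α c 1).reflect N = C c * (X ^ (N - α) * (1 - C 2 * X) ^ α) := by
  have hdeg : ((X - C (2 : k)) ^ α).natDegree ≤ α := by simp
  have h := reflect_mul (1 : k[X]) _ (natDegree_one.trans_le (Nat.zero_le (N - α))) hdeg
  rw [Nat.sub_add_cancel hαN, one_mul, reflect_one, reflect_X_sub_C_pow] at h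
  rw [basePoint, Matrix.cons_val_one, Matrix.cons_val_zero, reflect_C_mul, h]

theorem basePoint_one_mul_reflect [CharZero k] {N α : ℕ} (hαN : α ≤ N) (c d : k) :
    basePoint α c 1 * (basePoint α d 1).reflect N =
      C (c * d * (-2) ^ α) * X ^ (N - α) * (X - C 2) ^ α * (X - C 2⁻¹) ^ α := by
  have h : (1 : k[X]) - C 2 * X = C (-2) * (X - C 2⁻¹) := by
    rw [mul_sub, ← C_mul, neg_mul, mul_inv_cancel₀ two_ne_zero]
    simp only [C_neg, C_1]
    ring
  rw [basePoint_one_reflect hαN, h, basePoint, Matrix.cons_val_one, Matrix.cons_val_zero, C_mul,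
    C_mul, mul_pow, C_pow]
  ring

theorem eq_zero_of_mul_two_add_mul_inv_two_eq_zero [CharZero k] {m n : ℕ}
    (h : (m : k) * 2 + n * 2⁻¹ = 0) : m = 0 ∧ n = 0 := by
  have h4 : ((4 * m + n : ℕ) : k) = 0 := by
    push_cast
    linear_combination 2 * h - n * mul_inv_cancel₀ (two_ne_zero' k)
  have := Nat.cast_eq_zero.1 h4
  omega

theorem exponent_eq_zero_of_leadingCoeff_mul_eq [CharZero k] {m n : ℕ} {c : k} (hc : c ≠ 0)
    (h : c * (-2) ^ (m + n) * ((-2) ^ n * (-2⁻¹) ^ m) = c) : n = 0 := by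
  have h4 : (-2) ^ (m + n) * ((-2) ^ n * (-2⁻¹) ^ m) = (4 : k) ^ n := by
    calc (-2 : k) ^ (m + n) * ((-2) ^ n * (-2⁻¹) ^ m)
        = (-2 * -2⁻¹) ^ m * (-2 * -2) ^ n := by rw [mul_pow, mul_pow, pow_add]; ring
      _ = 4 ^ n := by norm_num
  rw [mul_assoc, h4, mul_eq_left₀ hc] at h
  have h1 : 4 ^ n = 1 := Nat.cast_injective (R := k) (by exact_mod_cast h)
  simpa using h1

theorem exists_of_mul_eq_X_pow {N : ℕ} {p q : k[X]} (h : p * q = X ^ N) :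
    ∃ (x : k) (i : ℕ), x ≠ 0 ∧ p = C x * X ^ i ∧ q.reflect N = C x⁻¹ * X ^ i := by
  obtain ⟨x, y, i, i', _, _, _, _, hxy, hi, hm, hn, hp, hq⟩ :=
    exists_of_mul_eq_C_mul_X_pow_mul (κ := (1 : k)) (a := 0) (b := 0) (E := N) (A := 0) (B := 0)
      one_ne_zero (by simpa using h)
  rw [Nat.add_eq_zero_iff] at hm hn
  simp only [hm, hn, pow_zero, mul_one] at hp hq
  refine ⟨x, i, left_ne_zero_of_mul_eq_one hxy, hp, ?_⟩
  rw [hq, reflect_C_mul_X_pow, revAt_le (by omega), eq_inv_of_mul_eq_one_right hxy,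
    show N - i' = i by omega]

theorem exists_of_mul_eq_basePoint_one_mul_reflect [CharZero k] {N α : ℕ} (hαN : α ≤ N)
    {d d' : k} (hd : d ≠ 0) (hd' : d' ≠ 0) {p q : k[X]}
    (h : p * q = basePoint α d 1 * (basePoint α d' 1).reflect N)
    (hqN : q.natDegree ≤ N) :
    ∃ (c c' : k) (e m m' n n' : ℕ), c ≠ 0 ∧ c * c' = d * d' * (-2) ^ α ∧ m + m' = α ∧ n + n' = α ∧
      p = C c * (X ^ e * ((X - C 2) ^ m * (X - C 2⁻¹) ^ n)) ∧ p.natDegree = e + (m + n) ∧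
      α ≤ p.natDegree ∧ (q.reflect N).natDegree = e + α ∧ e + α ≤ N ∧
      (q.reflect N).leadingCoeff = c' * ((-2) ^ m' * (-2⁻¹) ^ n') := by
  have h2 : (2 : k) ≠ 0 := two_ne_zero
  have hκ : d * d' * (-2) ^ α ≠ 0 :=
    mul_ne_zero (mul_ne_zero hd hd') (pow_ne_zero _ (neg_ne_zero.2 h2))
  obtain ⟨c, c', e, e', m, m', n, n', hcc', he, hm, hn, hp, hq⟩ :=
    exists_of_mul_eq_C_mul_X_pow_mul hκ (h.trans (basePoint_one_mul_reflect hαN _ _))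
  have hc : c ≠ 0 := left_ne_zero_of_mul (hcc' ▸ hκ)
  have hc' : c' ≠ 0 := right_ne_zero_of_mul (hcc' ▸ hκ)
  have hpdeg := natDegree_C_mul_X_pow_mul_X_sub_C_pow hc 2 2⁻¹ e m n
  have hqdeg := natDegree_C_mul_X_pow_mul_X_sub_C_pow hc' 2 2⁻¹ e' m' n'
  rw [← hp] at hpdeg
  rw [← hq] at hqdeg
  obtain ⟨hrdeg, hrlead⟩ := natDegree_and_leadingCoeff_reflect h2 (inv_ne_zero h2) hc'
    (show m' + n' ≤ e + α by omega) hq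
  rw [show e' + (e + α) = N by omega] at hrdeg hrlead
  exact ⟨c, c', e, m, m', n, n', hc, hcc', hm, hn, hp, hpdeg, by omega, hrdeg, by omega, hrlead⟩

theorem isRigid_basePoint [CharZero k] {N α : ℕ} (hα : 1 ≤ α) (hαN : α ≤ N) {r s : ℕ → k}
    (hr : r 0 ≠ 0) (hs : s 0 ≠ 0) :
    IsRigid N α r s (basePoint α (r 0)) (fun i => (basePoint α (s 0) i).reflect N) := by
  intro a p q ha hpN hqN hpq hp hq
  obtain ⟨x, i, hx, hp0, hq0⟩ := exists_of_mul_eq_X_pow (N := N) (by simpa [basePoint] using hpq 0)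
  obtain ⟨c, c', e, m, m', n, n', hc, hcc', hm, hn, hp1, hpdeg, hpα, hqdeg, heN, hqlead⟩ :=
    exists_of_mul_eq_basePoint_one_mul_reflect hαN hr hs (hpq 1) (hqN 1)
  obtain ⟨hpi, hqi, hlead, hnext⟩ := natDegree_eq_of_isLinked_of_isLinked ha
    (q := fun i => (q i).reflect N) hx hp0 hq0
    (ne_zero_of_natDegree_gt (n := 0) (by omega)) (ne_zero_of_natDegree_gt (n := 0) (by omega))
    hpα (hpN 1) (by omega) (by omega) hp hq
  obtain ⟨rfl, rfl⟩ : i = e ∧ α = m + n := by omega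
  obtain rfl : i = 0 := by
    by_contra hi
    have h0 := hnext hi
    rw [hp1, nextCoeff_C_mul_X_pow_mul_X_sub_C_pow, mul_eq_zero,
      or_iff_right (neg_ne_zero.2 hc)] at h0
    have := eq_zero_of_mul_two_add_mul_inv_two_eq_zero h0
    omega
  obtain rfl : n = 0 := by
    refine exponent_eq_zero_of_leadingCoeff_mul_eq (m := m) (mul_ne_zero hr hs) ?_
    have hplead : (p 1).leadingCoeff = c := by simp [hp1]
    rw [hqlead, hplead, show m' = n by omega, show n' = m by omega] at hlead
    rw [← hcc', ← hlead]
    ring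
  refine Fin.forall_fin_two.2 ⟨⟨x, hx, by simpa [basePoint] using hp0⟩,
    c / r 0, div_ne_zero hc hr, ?_⟩
  simp only [hp1, basePoint, Matrix.cons_val_one, Matrix.cons_val_zero, ← mul_assoc, ← C_mul,
    div_mul_cancel₀ _ hr, pow_zero, mul_one, add_zero]

end BasePoint

theorem exists_ultrafilter_of_submonoid {X k : Type*} [MonoidWithZero k] (S : Submonoid (X → k))
    (B : Set X) (h : ∀ f ∈ S, ∃ x ∈ B, f x ≠ 0) :
    ∃ U : Ultrafilter X, B ∈ U ∧ ∀ f ∈ S, ∀ᶠ x in U, f x ≠ 0 := by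
  have hne : NeBot (⨅ f : S, 𝓟 {x | x ∈ B ∧ f.1 x ≠ 0}) := by
    refine iInf_neBot_of_directed' (fun f g => ⟨f * g, ?_, ?_⟩)
      fun f => principal_neBot_iff.2 (h f f.2)
    · exact principal_mono.2 fun x hx => ⟨hx.1, left_ne_zero_of_mul hx.2⟩
    · exact principal_mono.2 fun x hx => ⟨hx.1, right_ne_zero_of_mul hx.2⟩
  have hU (f : S) : {x | x ∈ B ∧ f.1 x ≠ 0} ∈ Ultrafilter.of (⨅ f : S, 𝓟 {x | x ∈ B ∧ f.1 x ≠ 0}) :=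
    Ultrafilter.of_le _ (mem_iInf_of_mem f (mem_principal_self _))
  exact ⟨_, mem_of_superset (hU 1) fun x hx => hx.1,
    fun f hf => mem_of_superset (hU ⟨f, hf⟩) fun x hx => hx.2⟩

theorem exists_valuationSubring_of_forall_ne_zero {A k K : Type*} [CommRing A] [Field k] [Field K]
    [Algebra k A] (ev : A →ₐ[k] k) (φ : A →+* K) (h : ∀ a, ev a ≠ 0 → φ a ≠ 0) :
    ∃ (V : ValuationSubring K) (θ : A →+* V) (ι : k →+* ResidueField V),
      (∀ a, (θ a : K) = φ a) ∧ ∀ a, residue V (θ a) = ι (ev a) := by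
  let q : Ideal A := RingHom.ker ev
  have : q.IsPrime := RingHom.ker_isPrime ev
  let f : Localization.AtPrime q →+* K := IsLocalization.lift (M := q.primeCompl)
    (g := φ) fun a => isUnit_iff_ne_zero.2 (h a a.2)
  obtain ⟨V, hV, hloc⟩ := IsLocalRing.exists_factor_valuationRing f
  let θ : A →+* V := (f.codRestrict V.toSubring hV).comp (algebraMap A _)
  have hker : ∀ a, ev a = 0 → residue V (θ a) = 0 := by
    intro a ha
    rw [residue_eq_zero_iff, mem_maximalIdeal, mem_nonunits_iff]
    intro hunit
    have := hloc.map_nonunit _ hunit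
    rw [IsLocalization.AtPrime.isUnit_to_map_iff _ q] at this
    exact this ha
  refine ⟨V, θ, (residue V).comp (θ.comp (algebraMap k A)), fun a => IsLocalization.lift_eq _ a,
    fun a => ?_⟩
  have := hker (a - algebraMap k A (ev a)) (by simp)
  rwa [map_sub, map_sub, sub_eq_zero] at this

section BasePoint

theorem basePoint_map {R S : Type*} [CommRing R] [CommRing S] (f : R →+* S) (α : ℕ) (c : R)
    (i : Fin 2) : (basePoint α c i).map f = basePoint α (f c) i := by
  fin_cases i <;> simp [basePoint, map_ofNat f 2]

variable {k : Type*} [Field k] [CharZero k]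

theorem coeff_zero_basePoint_ne_zero (α : ℕ) {c : k} (hc : c ≠ 0) (i : Fin 2) :
    (basePoint α c i).coeff 0 ≠ 0 := by
  fin_cases i <;> simp [basePoint, coeff_zero_eq_eval_zero, hc]

theorem isCoprime_basePoint_reflect {N α : ℕ} (hαN : α ≤ N) {c d : k} (hc : c ≠ 0) (hd : d ≠ 0)
    (i : Fin 2) : IsCoprime (basePoint α c i) ((basePoint α d i).reflect N) := by
  fin_cases i
  · exact isCoprime_one_left
  have hroot : ¬ ((basePoint α d 1).reflect N).IsRoot 2 := by
    norm_num [basePoint_one_reflect hαN, hd]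
  have hcop := (irreducible_X_sub_C (2 : k)).coprime_iff_not_dvd.2 (dvd_iff_isRoot.not.2 hroot)
  exact (isCoprime_mul_unit_left_left (isUnit_C.2 hc.isUnit) _ _).2 hcop.pow_left

end BasePoint

theorem exists_eq_C_mul_map_of_map_residue_eq_basePoint {V K : Type*} [CommRing V] [IsDomain V]
    [ValuationRing V] [Field K] [Algebra V K] [IsFractionRing V K] [CharZero (ResidueField V)]
    {N α : ℕ} (hα : 1 ≤ α) (hαN : α ≤ N) {r s : ℕ → V} (hr : residue V (r 0) ≠ 0)
    (hs : residue V (s 0) ≠ 0) {P Q : Fin 2 → V[X]}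
    (hP : ∀ i, (P i).map (residue V) = basePoint α (residue V (r 0)) i)
    (hQ : ∀ i, (Q i).map (residue V) = basePoint α (residue V (s 0)) i)
    (hQN : ∀ i, (Q i).natDegree ≤ N)
    {p q : Fin 2 → K[X]} (hpN : ∀ i, (p i).natDegree ≤ N) (hqN : ∀ i, (q i).natDegree ≤ N)
    (hpq : ∀ i, p i * (q i).reflect N = (P i * (Q i).reflect N).map (algebraMap V K))
    (hp : IsLinked N α (algebraMap V K ∘ r) p) (hq : IsLinked N α (algebraMap V K ∘ s) q)
    (i : Fin 2) : ∃ γ : K, p i = C γ * (P i).map (algebraMap V K) := by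
  have hQred j : ((Q j).reflect N).map (residue V) =
      (basePoint α (residue V (s 0)) j).reflect N := by rw [← reflect_map, hQ]
  have hunit j : IsUnit (((Q j).reflect N).coeff N) := by
    rw [← residue_ne_zero_iff_isUnit, ← coeff_map, hQred, coeff_reflect, revAt_le le_rfl,
      Nat.sub_self]
    exact coeff_zero_basePoint_ne_zero α hs j
  have hdeg j : ((Q j).reflect N).natDegree = N :=
    (natDegree_reflect_le.trans_eq (max_eq_left (hQN j))).antisymm
      (le_natDegree_of_ne_zero (hunit j).ne_zero)
  refine IsRigid.exists_eq_C_mul_map (s := s) (Q := fun j => (Q j).reflect N)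
    (q := fun j => (q j).reflect N) ?_ (fun j => ?_) (fun j => ?_) hdeg (fun j => ?_) hpN
    (fun j => natDegree_reflect_le.trans_eq (max_eq_left (hqN j))) hpq hp ?_ i
  · simp only [hP, hQred]
    exact isRigid_basePoint hα hαN hr hs
  · rw [hP, hQred]
    exact isCoprime_basePoint_reflect hαN hr hs j
  · exact fun h0 => coeff_zero_basePoint_ne_zero α hr j (by rw [← hP, h0, coeff_zero])
  · rw [leadingCoeff, hdeg]
    exact hunit j
  · simpa only [reflect_reflect] using hq

theorem exists_eq_C_mul_map_of_map_eq_basePoint {A k K : Type*} [CommRing A] [Field k]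
    [CharZero k] [Field K] [Algebra k A] (ev : A →ₐ[k] k) (φ : A →+* K)
    (h : ∀ a, ev a ≠ 0 → φ a ≠ 0) {N α : ℕ} (hα : 1 ≤ α) (hαN : α ≤ N) {r s : ℕ → k}
    (hr : r 0 ≠ 0) (hs : s 0 ≠ 0) {P Q : Fin 2 → A[X]}
    (hP : ∀ i, (P i).map (ev : A →+* k) = basePoint α (r 0) i)
    (hQ : ∀ i, (Q i).map (ev : A →+* k) = basePoint α (s 0) i) (hQN : ∀ i, (Q i).natDegree ≤ N)
    {p q : Fin 2 → K[X]} (hpN : ∀ i, (p i).natDegree ≤ N) (hqN : ∀ i, (q i).natDegree ≤ N)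
    (hpq : ∀ i, p i * (q i).reflect N = (P i * (Q i).reflect N).map φ)
    (hp : IsLinked N α (φ ∘ algebraMap k A ∘ r) p)
    (hq : IsLinked N α (φ ∘ algebraMap k A ∘ s) q) (i : Fin 2) :
    ∃ γ : K, p i = C γ * (P i).map φ := by
  obtain ⟨V, θ, ι, hθ, hι⟩ := exists_valuationSubring_of_forall_ne_zero ev φ h
  have : CharZero (ResidueField V) := charZero_of_injective_ringHom ι.injective
  obtain rfl : φ = (algebraMap V K).comp θ := RingHom.ext fun a => (hθ a).symm
  have hconst (c : k) : residue V (θ (algebraMap k A c)) = ι c := by rw [hι, ev.commutes]; rfl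
  have hred {F : A[X]} {c : k} {j : Fin 2} (hF : F.map (ev : A →+* k) = basePoint α c j) :
      (F.map θ).map (residue V) = basePoint α (residue V (θ (algebraMap k A c))) j := by
    have hres : (residue V).comp θ = ι.comp ev := RingHom.ext hι
    rw [Polynomial.map_map, hres, ← Polynomial.map_map, hF, basePoint_map, hconst]
  rw [← Polynomial.map_map]
  refine exists_eq_C_mul_map_of_map_residue_eq_basePoint hα hαN (P := fun j => (P j).map θ)
    (Q := fun j => (Q j).map θ) (r := θ ∘ algebraMap k A ∘ r) (s := θ ∘ algebraMap k A ∘ s)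
    ((hconst _).trans_ne ((map_ne_zero ι).2 hr)) ((hconst _).trans_ne ((map_ne_zero ι).2 hs))
    (fun j => hred (hP j)) (fun j => hred (hQ j)) (fun j => natDegree_map_le.trans (hQN j))
    hpN hqN (fun j => ?_) hp hq i
  rw [hpq, ← Polynomial.map_map, Polynomial.map_mul θ, reflect_map]

theorem IsLinked.exists_common_scalar {k : Type*} [Field k] {N α : ℕ} (hαN : α ≤ N) {r : ℕ → k}
    {P p : Fin 2 → k[X]} (hP : IsLinked N α r P) (hp : IsLinked N α r p) (hr : r 0 ≠ 0)
    (hP0 : (P 0).coeff 0 ≠ 0) (h : ∀ i, ∃ γ, p i = C γ * P i) : ∃ γ, ∀ i, p i = C γ * P i := by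
  choose γ hγ using h
  have hP1 := hP 0 (by omega)
  have hp1 := hp 0 (by omega)
  rw [hγ, hγ, coeff_C_mul, coeff_C_mul, hP1] at hp1
  have hγ1 : γ 1 = γ 0 := mul_right_cancel₀ (mul_ne_zero hr hP0) (by linear_combination hp1)
  exact ⟨γ 0, Fin.forall_fin_two.2 ⟨hγ 0, hγ1 ▸ hγ 1⟩⟩

theorem isLinked_basePoint {R : Type*} [CommRing R] {N α : ℕ} (r : ℕ → R) :
    IsLinked N α r (basePoint α (r 0)) := by
  intro j _
  have hX : (X - C (2 : R)) ^ α = (X + C (-2)) ^ α := by rw [C_neg, sub_eq_add_neg]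
  simp only [basePoint, Matrix.cons_val_one, Matrix.cons_val_zero, coeff_C_mul, hX,
    coeff_X_add_C_pow, coeff_one]
  rcases eq_or_ne j 0 with rfl | hj
  · simp
  · simp [hj, Nat.choose_eq_zero_of_lt (show α < j + α by omega)]

section PairPolynomial

variable {R S : Type*} [CommRing R] [CommRing S] {W N : ℕ}

open scoped Classical in
theorem map_ofFn (f : R →+* S) (v : Fin W → R) : (ofFn W v).map f = ofFn W (f ∘ v) := by
  ext n
  by_cases h : n < W
  · simp [h]
  · simp [not_lt.1 h]

open scoped Classical in
/-- The polynomials `y₀[0] + y₀[1] X + ⋯` and `y_α[0] + y_α[1] X + ⋯` of a pair of vectors. -/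
noncomputable def pairPolynomial (y : (Fin W → R) × (Fin W → R)) : Fin 2 → R[X] :=
  ![ofFn W y.1, ofFn W y.2]

theorem pairPolynomial_map (f : R →+* S) (y : (Fin W → R) × (Fin W → R)) (i : Fin 2) :
    (pairPolynomial y i).map f = pairPolynomial (f ∘ y.1, f ∘ y.2) i := by
  fin_cases i <;> exact map_ofFn _ _

theorem natDegree_pairPolynomial_le (y : (Fin (N + 1) → R) × (Fin (N + 1) → R)) (i : Fin 2) :
    (pairPolynomial y i).natDegree ≤ N := by
  classical
  fin_cases i <;> exact Nat.lt_succ_iff.1 (ofFn_natDegree_lt N.succ_pos _)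

theorem pairPolynomial_injective :
    Function.Injective (pairPolynomial : (Fin W → R) × (Fin W → R) → Fin 2 → R[X]) := by
  classical
  exact fun y z h => Prod.ext (injective_ofFn W (congrFun h 0)) (injective_ofFn W (congrFun h 1))

theorem pairPolynomial_smul (c : R) (y : (Fin W → R) × (Fin W → R)) (i : Fin 2) :
    pairPolynomial (c • y) i = C c * pairPolynomial y i := by
  rw [← smul_eq_C_mul]
  fin_cases i <;> exact map_smul _ _ _

theorem exists_pairPolynomial_eq {p : Fin 2 → R[X]} (hp : ∀ i, (p i).natDegree ≤ N) :
    ∃ y : (Fin (N + 1) → R) × (Fin (N + 1) → R), pairPolynomial y = p := by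
  classical
  refine ⟨(toFn (N + 1) (p 0), toFn (N + 1) (p 1)), funext <| Fin.forall_fin_two.2
    ⟨?_, ?_⟩⟩ <;> exact ofFn_comp_toFn_eq_id_of_natDegree_lt (Nat.lt_succ_iff.2 (hp _))

end PairPolynomial

section Relations

variable {N α : ℕ} {w : Fin (N + 1) → ℂ}

/-- The ratios `w[j+α] / w[j]` that occur in the relations defining `Z`; beyond the range of `w`
their values are irrelevant. -/
noncomputable def windowRatio {W : ℕ} (α : ℕ) (w : Fin W → ℂ) (j : ℕ) : ℂ :=
  (ofFn W w).coeff (j + α) / (ofFn W w).coeff j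

theorem windowRatio_zero_ne_zero (hw : ∀ n, w n ≠ 0) (hαN : α ≤ N) : windowRatio α w 0 ≠ 0 := by
  rw [windowRatio, ofFn_coeff_eq_val_of_lt _ (by omega), ofFn_coeff_eq_val_of_lt _ (by omega)]
  exact div_ne_zero (hw _) (hw _)

theorem mem_linearRelations_iff (hw : ∀ n, w n ≠ 0) {y : (Fin (N + 1) → ℂ) × (Fin (N + 1) → ℂ)} :
    y ∈ linearRelations α w ↔ IsLinked N α (windowRatio α w) (pairPolynomial y) := by
  have hcoeff (j : ℕ) (hj : j + α < N + 1) :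
      (pairPolynomial y 1).coeff (j + α) = windowRatio α w j * (pairPolynomial y 0).coeff j ↔
        w ⟨j + α, hj⟩ * y.1 ⟨j, by omega⟩ = w ⟨j, by omega⟩ * y.2 ⟨j + α, hj⟩ := by
    have h1 : (pairPolynomial y 1).coeff (j + α) = y.2 ⟨j + α, hj⟩ := ofFn_coeff_eq_val_of_lt _ hj
    have h0 : (pairPolynomial y 0).coeff j = y.1 ⟨j, by omega⟩ := ofFn_coeff_eq_val_of_lt _ _
    rw [h0, h1, windowRatio, ofFn_coeff_eq_val_of_lt _ hj, ofFn_coeff_eq_val_of_lt _ (by omega),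
      div_mul_eq_mul_div, eq_div_iff (hw _), eq_comm, mul_comm (w ⟨j, _⟩)]
  exact ⟨fun h j hj => (hcoeff j (by omega)).2 (h j (by omega)),
    fun h j hj => (hcoeff j hj).1 (h j (by omega))⟩

end Relations

section Intensity

variable {W N : ℕ}

theorem infinite_range_coe_circle : (Set.range fun ω : Circle => (ω : ℂ)).Infinite := by
  have : Infinite (Set.Ioc (-Real.pi) Real.pi) :=
    (Set.Ioc_infinite (by linarith [Real.pi_pos])).to_subtype
  have : Infinite Circle := Circle.argEquiv.infinite_iff.2 this
  exact Set.infinite_range_of_injective Circle.coe_injective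

theorem eval_ofFn (y : Fin W → ℂ) (ω : Circle) : (ofFn W y).eval (ω : ℂ) = fourier y ω := by
  simp [ofFn_eq_sum_monomial, eval_finsetSum, fourier]

theorem eval_reflect_map_conj {p : ℂ[X]} (hp : p.natDegree ≤ N) (ω : Circle) :
    ((p.map (starRingEnd ℂ)).reflect N).eval (ω : ℂ) = ω ^ N * conj (p.eval (ω : ℂ)) := by
  let _ : Invertible (ω : ℂ)⁻¹ := invertibleOfNonzero (inv_ne_zero ω.coe_ne_zero)
  have h := eval₂_reflect_mul_pow (RingHom.id ℂ) (ω : ℂ)⁻¹ N (p.map (starRingEnd ℂ))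
    (natDegree_map_le.trans hp)
  have hconj : (p.map (starRingEnd ℂ)).eval (ω : ℂ)⁻¹ = conj (p.eval (ω : ℂ)) := by
    rw [← Circle.coe_inv, Circle.coe_inv_eq_conj, eval_map, eval₂_at_apply]
  rw [eval₂_id, eval₂_id, hconj, invOf_eq_inv, inv_inv, inv_pow] at h
  rw [← h]
  field_simp

theorem ofFn_mul_reflect_eq_of_fourierIntensity_eq {y y' : Fin (N + 1) → ℂ}
    (h : fourierIntensity y = fourierIntensity y') :
    ofFn (N + 1) y * ((ofFn (N + 1) y).map (starRingEnd ℂ)).reflect N =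
      ofFn (N + 1) y' * ((ofFn (N + 1) y').map (starRingEnd ℂ)).reflect N := by
  refine eq_of_infinite_eval_eq _ _ (infinite_range_coe_circle.mono ?_)
  rintro _ ⟨ω, rfl⟩
  have hdeg (v : Fin (N + 1) → ℂ) := Nat.lt_succ_iff.1 (ofFn_natDegree_lt N.succ_pos v)
  have hω : (‖fourier y ω‖ : ℂ) ^ 2 = ‖fourier y' ω‖ ^ 2 := by exact_mod_cast congrFun h ω
  simp only [Set.mem_ofPred_eq, eval_mul, eval_reflect_map_conj (hdeg _), eval_ofFn]
  rw [mul_left_comm, mul_left_comm (fourier y' ω), Complex.mul_conj', Complex.mul_conj', hω]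

theorem pairPolynomial_mul_reflect_eq_of_fourierIntensity_eq
    {y y' : (Fin (N + 1) → ℂ) × (Fin (N + 1) → ℂ)}
    (h₀ : fourierIntensity y.1 = fourierIntensity y'.1)
    (h₁ : fourierIntensity y.2 = fourierIntensity y'.2) (i : Fin 2) :
    pairPolynomial y i * ((pairPolynomial y i).map (starRingEnd ℂ)).reflect N =
      pairPolynomial y' i * ((pairPolynomial y' i).map (starRingEnd ℂ)).reflect N := by
  fin_cases i
  · convert! ofFn_mul_reflect_eq_of_fourierIntensity_eq h₀
  · convert! ofFn_mul_reflect_eq_of_fourierIntensity_eq h₁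

theorem exists_fourier_ne_zero {y : Fin W → ℂ} (hy : y ≠ 0) : ∃ ω, fourier y ω ≠ 0 := by
  by_contra! h
  refine hy (injective_ofFn W ?_)
  rw [ofFn_zero]
  refine eq_of_infinite_eval_eq _ _ (infinite_range_coe_circle.mono ?_)
  rintro _ ⟨ω, rfl⟩
  simp [eval_ofFn, h]

theorem norm_eq_one_of_fourierIntensity_eq {y : Fin W → ℂ} (hy : y ≠ 0) {c : ℂ}
    (h : fourierIntensity y = fourierIntensity (c • y)) : ‖c‖ = 1 := by
  obtain ⟨ω, hω⟩ := exists_fourier_ne_zero hy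
  have hc : fourier (c • y) ω = c * fourier y ω := by
    simp [fourier, Finset.mul_sum, mul_assoc]
  have := congrFun h ω
  simp only [fourierIntensity, hc, norm_mul, mul_pow] at this
  have hc1 : ‖c‖ ^ 2 = 1 := by
    rw [← mul_eq_right₀ (pow_ne_zero 2 (norm_ne_zero_iff.2 hω)), ← this]
  exact (pow_eq_one_iff_of_nonneg (norm_nonneg c) two_ne_zero).1 hc1

theorem exists_phase_of_fourierIntensity_eq {y y' : (Fin W → ℂ) × (Fin W → ℂ)} {c : ℂ}
    (hc : y' = c • y) (h₀ : fourierIntensity y.1 = fourierIntensity y'.1)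
    (h₁ : fourierIntensity y.2 = fourierIntensity y'.2) :
    ∃ θ : ℝ, y' = Complex.exp (θ * Complex.I) • y := by
  subst hc
  rcases eq_or_ne y 0 with rfl | hy
  · exact ⟨0, by simp⟩
  have hnorm : ‖c‖ = 1 := by
    by_cases hy₀ : y.1 = 0
    · exact norm_eq_one_of_fourierIntensity_eq (fun hy₁ => hy (Prod.ext hy₀ hy₁)) h₁
    · exact norm_eq_one_of_fourierIntensity_eq hy₀ h₀
  obtain ⟨θ, rfl⟩ := Complex.norm_eq_one_iff c |>.1 hnorm
  exact ⟨θ, rfl⟩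

end Intensity

section Germ

variable {X k : Type*} [CommRing k] {l : Filter X}

theorem map_coeRingHom_eq_iff {p q : (X → k)[X]} :
    p.map (Germ.coeRingHom l) = q.map (Germ.coeRingHom l) ↔
      ∀ᶠ x in l, p.map (Pi.evalRingHom _ x) = q.map (Pi.evalRingHom _ x) := by
  have hcoeff (n : ℕ) : (p.map (Germ.coeRingHom l)).coeff n = (q.map (Germ.coeRingHom l)).coeff n ↔
      ∀ᶠ x in l, p.coeff n x = q.coeff n x := by
    rw [coeff_map, coeff_map]
    exact Germ.coe_eq
  constructor
  · intro h
    have := (eventually_all_finset (p.support ∪ q.support)).2 fun n _ =>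
      (hcoeff n).1 (congrArg (coeff · n) h)
    filter_upwards [this] with x hx
    ext n
    by_cases hn : n ∈ p.support ∪ q.support
    · simpa using hx n hn
    · simp_all
  · intro h
    ext n
    rw [hcoeff]
    filter_upwards [h] with x hx
    simpa using congrArg (coeff · n) hx

theorem isLinked_map_coeRingHom {N α : ℕ} {r : ℕ → X → k} {p : Fin 2 → (X → k)[X]}
    (h : ∀ᶠ x in l, IsLinked N α (fun j => r j x) fun i => (p i).map (Pi.evalRingHom _ x)) :
    IsLinked N α (Germ.coeRingHom l ∘ r) fun i => (p i).map (Germ.coeRingHom l) := by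
  intro j hj
  rw [coeff_map, coeff_map, Function.comp_apply, ← map_mul]
  refine Germ.coe_eq.2 ?_
  filter_upwards [h] with x hx
  simpa using hx j hj

end Germ

section Family

/-- The polynomials of a family of pairs of vectors, with functions on the index set as
coefficients. -/
noncomputable def familyPolynomial {X k : Type*} [CommRing k] {W : ℕ}
    (y : X → (Fin W → k) × (Fin W → k)) : Fin 2 → (X → k)[X] :=
  pairPolynomial (fun n x => (y x).1 n, fun n x => (y x).2 n)

theorem familyPolynomial_map_eval {X k : Type*} [CommRing k] {W : ℕ}
    (y : X → (Fin W → k) × (Fin W → k)) (i : Fin 2) (x : X) :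
    (familyPolynomial y i).map (Pi.evalRingHom _ x) = pairPolynomial (y x) i :=
  pairPolynomial_map _ _ i

/-- The polynomials of a germ of families of pairs of vectors, with germs as coefficients. -/
noncomputable def germPolynomial {X k : Type*} [CommRing k] {W : ℕ}
    (y : X → (Fin W → k) × (Fin W → k)) (l : Filter X) (i : Fin 2) : (Germ l k)[X] :=
  (familyPolynomial y i).map (Germ.coeRingHom l)

end Family

section Coordinates

variable {W : ℕ}

/-- Evaluation of a complex polynomial in the `4W` real coordinates of a pair of vectors. -/
noncomputable def evalRealCoords (z : (Fin W → ℂ) × (Fin W → ℂ)) :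
    MvPolynomial ((Fin W ⊕ Fin W) ⊕ (Fin W ⊕ Fin W)) ℂ →ₐ[ℂ] ℂ :=
  MvPolynomial.aeval fun i => (realCoords z i : ℂ)

/-- The polynomials `Re + c Im` in the real coordinates, one for each entry of the pair: for
`c = i` the entries themselves, for `c = -i` their conjugates. -/
noncomputable def coordinatePair (c : ℂ) :
    (Fin W → MvPolynomial ((Fin W ⊕ Fin W) ⊕ (Fin W ⊕ Fin W)) ℂ) ×
      (Fin W → MvPolynomial ((Fin W ⊕ Fin W) ⊕ (Fin W ⊕ Fin W)) ℂ) :=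
  (fun n => .X (.inl (.inl n)) + .C c * .X (.inr (.inl n)),
    fun n => .X (.inl (.inr n)) + .C c * .X (.inr (.inr n)))

theorem pairPolynomial_star (z : (Fin W → ℂ) × (Fin W → ℂ)) (i : Fin 2) :
    pairPolynomial (star z) i = (pairPolynomial z i).map (starRingEnd ℂ) := by
  rw [pairPolynomial_map]
  rfl

theorem pairPolynomial_coordinatePair_I_map (z : (Fin W → ℂ) × (Fin W → ℂ)) (i : Fin 2) :
    (pairPolynomial (coordinatePair (W := W) Complex.I) i).map (evalRealCoords z : _ →+* ℂ) =
      pairPolynomial z i := by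
  rw [pairPolynomial_map]
  congr 1
  ext n <;> simp [coordinatePair, evalRealCoords, realCoords, mul_comm Complex.I]

theorem pairPolynomial_coordinatePair_neg_I_map (z : (Fin W → ℂ) × (Fin W → ℂ)) (i : Fin 2) :
    (pairPolynomial (coordinatePair (W := W) (-Complex.I)) i).map (evalRealCoords z : _ →+* ℂ) =
      pairPolynomial (star z) i := by
  have hconj (a : ℂ) : (a.re : ℂ) + -Complex.I * a.im = conj a := by
    simp [Complex.ext_iff]
  rw [pairPolynomial_map]
  congr 1
  ext n <;> simpa [coordinatePair, evalRealCoords, realCoords] using hconj _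

section Germ

variable {X : Type*}

/-- The germ along `l` of a polynomial in the real coordinates of a family of pairs. -/
noncomputable def germRealCoords (z : X → (Fin W → ℂ) × (Fin W → ℂ)) (l : Filter X) :
    MvPolynomial ((Fin W ⊕ Fin W) ⊕ (Fin W ⊕ Fin W)) ℂ →+* Germ l ℂ :=
  (Germ.coeRingHom l).comp (RingHom.pi fun x => (evalRealCoords (z x) : _ →+* ℂ))

variable {z : X → (Fin W → ℂ) × (Fin W → ℂ)} {l : Filter X}

theorem germRealCoords_comp_algebraMap (r : ℕ → ℂ) :
    germRealCoords z l ∘ algebraMap ℂ _ ∘ r = Germ.coeRingHom l ∘ fun j _ => r j :=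
  funext fun j => congrArg (Germ.coeRingHom l) <|
    funext fun x => (evalRealCoords (z x)).commutes (r j)

theorem germRealCoords_ne_zero [l.NeBot] {F : MvPolynomial ((Fin W ⊕ Fin W) ⊕ (Fin W ⊕ Fin W)) ℂ}
    (hF : ∀ᶠ x in l, evalRealCoords (z x) F ≠ 0) : germRealCoords z l F ≠ 0 := fun h => by
  have h0 : ∀ᶠ x in l, evalRealCoords (z x) F = 0 := Germ.coe_eq.1 h
  obtain ⟨x, hx, hx0⟩ := (hF.and h0).exists
  exact hx hx0

theorem map_germRealCoords_eq {p : (MvPolynomial ((Fin W ⊕ Fin W) ⊕ (Fin W ⊕ Fin W)) ℂ)[X]}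
    {q : (X → ℂ)[X]}
    (h : ∀ x, p.map (evalRealCoords (z x) : _ →+* ℂ) = q.map (Pi.evalRingHom _ x)) :
    p.map (germRealCoords z l) = q.map (Germ.coeRingHom l) := by
  rw [germRealCoords, ← Polynomial.map_map, map_coeRingHom_eq_iff]
  exact .of_forall fun x => by rw [Polynomial.map_map, ← h]; rfl

theorem pairPolynomial_coordinatePair_I_map_germRealCoords (i : Fin 2) :
    (pairPolynomial (coordinatePair Complex.I) i).map (germRealCoords z l) =
      germPolynomial z l i :=
  map_germRealCoords_eq fun x => (pairPolynomial_coordinatePair_I_map (z x) i).trans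
    (familyPolynomial_map_eval z i x).symm

theorem pairPolynomial_coordinatePair_neg_I_map_germRealCoords (i : Fin 2) :
    (pairPolynomial (coordinatePair (-Complex.I)) i).map (germRealCoords z l) =
      germPolynomial (star z) l i :=
  map_germRealCoords_eq fun x => (pairPolynomial_coordinatePair_neg_I_map (z x) i).trans
    (familyPolynomial_map_eval (star z) i x).symm

end Germ

theorem exists_eval_add_eval_mul_I {σ : Type*} (F : MvPolynomial σ ℂ) :
    ∃ p q : MvPolynomial σ ℝ, ∀ x : σ → ℝ, MvPolynomial.aeval (fun i => (x i : ℂ)) F =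
      MvPolynomial.eval x p + MvPolynomial.eval x q * Complex.I := by
  induction F using MvPolynomial.induction_on with
  | C a => exact ⟨.C a.re, .C a.im, fun x => by simp⟩
  | add F G hF hG =>
    obtain ⟨p, q, hF⟩ := hF
    obtain ⟨p', q', hG⟩ := hG
    refine ⟨p + p', q + q', fun x => ?_⟩
    simp only [map_add, hF, hG, Complex.ofReal_add]
    ring
  | mul_X F i hF =>
    obtain ⟨p, q, hF⟩ := hF
    refine ⟨p * .X i, q * .X i, fun x => ?_⟩
    simp only [map_mul, hF, MvPolynomial.aeval_X, MvPolynomial.eval_X, Complex.ofReal_mul]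
    ring

theorem exists_evalRealCoords_ne_zero_of_not_genericOn
    {Z : Submodule ℂ ((Fin W → ℂ) × (Fin W → ℂ))} {P : (Fin W → ℂ) × (Fin W → ℂ) → Prop}
    (hP : ¬ GenericOn Z P) {z₀ : (Fin W → ℂ) × (Fin W → ℂ)} (hz₀ : z₀ ∈ Z)
    {F : MvPolynomial ((Fin W ⊕ Fin W) ⊕ (Fin W ⊕ Fin W)) ℂ} (hF : evalRealCoords z₀ F ≠ 0) :
    ∃ z ∈ {z ∈ Z | ¬ P z}, evalRealCoords z F ≠ 0 := by
  obtain ⟨p, q, hpq⟩ := exists_eval_add_eval_mul_I F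
  have hnormSq z : MvPolynomial.eval (realCoords z) (p ^ 2 + q ^ 2) =
      Complex.normSq (evalRealCoords z F) := by
    rw [evalRealCoords, hpq, Complex.normSq_add_mul_I, map_add, map_pow, map_pow]
  by_contra! h
  refine hP ⟨p ^ 2 + q ^ 2, ⟨z₀, hz₀, ?_⟩, fun z hz hne => ?_⟩
  · rwa [hnormSq, Ne, Complex.normSq_eq_zero]
  · by_contra hPz
    exact hne (by rw [hnormSq, h z ⟨hz, hPz⟩, map_zero])

theorem exists_ultrafilter_of_not_genericOn
    {Z : Submodule ℂ ((Fin W → ℂ) × (Fin W → ℂ))} {P : (Fin W → ℂ) × (Fin W → ℂ) → Prop}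
    (hP : ¬ GenericOn Z P) {z₀ : (Fin W → ℂ) × (Fin W → ℂ)} (hz₀ : z₀ ∈ Z) :
    ∃ U : Ultrafilter ((Fin W → ℂ) × (Fin W → ℂ)), (∀ᶠ z in U, z ∈ Z ∧ ¬ P z) ∧
      ∀ F, evalRealCoords z₀ F ≠ 0 → ∀ᶠ z in U, evalRealCoords z F ≠ 0 := by
  let S := (nonZeroDivisors ℂ).comap (evalRealCoords z₀)
  obtain ⟨U, hUB, hU⟩ := exists_ultrafilter_of_submonoid
    (S.map (RingHom.pi fun z => (evalRealCoords z : _ →+* ℂ))) {z ∈ Z | ¬ P z} <| by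
    rintro _ ⟨F, hF, rfl⟩
    exact exists_evalRealCoords_ne_zero_of_not_genericOn hP hz₀ (nonZeroDivisors.ne_zero hF)
  exact ⟨U, hUB, fun F hF => hU _ ⟨F, mem_nonZeroDivisors_of_ne_zero hF, rfl⟩⟩

end Coordinates

section Reconstruction

variable {N α : ℕ} {w : Fin (N + 1) → ℂ}

theorem exists_mem_linearRelations_pairPolynomial_eq_basePoint (hαN : α ≤ N)
    (hw : ∀ n, w n ≠ 0) :
    ∃ z ∈ linearRelations α w, pairPolynomial z = basePoint α (windowRatio α w 0) := by
  have hdeg (i : Fin 2) : (basePoint α (windowRatio α w 0) i).natDegree ≤ N := by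
    fin_cases i
    · simp [basePoint]
    · refine (natDegree_C_mul_le _ _).trans (hαN.trans' ?_)
      simp
  obtain ⟨z, hz⟩ := exists_pairPolynomial_eq hdeg
  exact ⟨z, (mem_linearRelations_iff hw).2 (hz ▸ isLinked_basePoint _), hz⟩

section Family

variable {X : Type*} {l : Filter X} {y z : X → (Fin (N + 1) → ℂ) × (Fin (N + 1) → ℂ)}

theorem natDegree_germPolynomial_le (i : Fin 2) : (germPolynomial y l i).natDegree ≤ N :=
  natDegree_map_le.trans (natDegree_pairPolynomial_le _ _)

theorem isLinked_germPolynomial (hw : ∀ n, w n ≠ 0)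
    (hy : ∀ᶠ x in l, y x ∈ linearRelations α w) :
    IsLinked N α (Germ.coeRingHom l ∘ fun j _ => windowRatio α w j) (germPolynomial y l) :=
  isLinked_map_coeRingHom <| hy.mono fun x hx => by
    simpa only [familyPolynomial_map_eval] using (mem_linearRelations_iff hw).1 hx

theorem isLinked_germPolynomial_star (hw : ∀ n, w n ≠ 0)
    (hy : ∀ᶠ x in l, y x ∈ linearRelations α w) :
    IsLinked N α (Germ.coeRingHom l ∘ fun j _ => conj (windowRatio α w j))
      (germPolynomial (star y) l) :=
  isLinked_map_coeRingHom <| hy.mono fun x hx => by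
    simp only [familyPolynomial_map_eval, Pi.star_apply, pairPolynomial_star]
    exact ((mem_linearRelations_iff hw).1 hx).map (starRingEnd ℂ)

theorem germPolynomial_mul_reflect_eq
    (h₀ : ∀ᶠ x in l, fourierIntensity (z x).1 = fourierIntensity (y x).1)
    (h₁ : ∀ᶠ x in l, fourierIntensity (z x).2 = fourierIntensity (y x).2) (i : Fin 2) :
    germPolynomial y l i * (germPolynomial (star y) l i).reflect N =
      germPolynomial z l i * (germPolynomial (star z) l i).reflect N := by
  simp only [germPolynomial, reflect_map, ← Polynomial.map_mul]
  rw [map_coeRingHom_eq_iff]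
  filter_upwards [h₀, h₁] with x hx₀ hx₁
  simpa only [Polynomial.map_mul, ← reflect_map, familyPolynomial_map_eval, Pi.star_apply,
    pairPolynomial_star]
    using (pairPolynomial_mul_reflect_eq_of_fourierIntensity_eq hx₀ hx₁ i).symm

theorem exists_eventually_eq_smul_of_germ {γ : Germ l ℂ}
    (hγ : ∀ i, germPolynomial y l i = C γ * germPolynomial z l i) :
    ∃ c : X → ℂ, ∀ᶠ x in l, y x = c x • z x := by
  induction γ using Germ.inductionOn with | _ c =>
  refine ⟨c, ?_⟩
  have h (i : Fin 2) : ∀ᶠ x in l, pairPolynomial (y x) i = pairPolynomial (c x • z x) i := by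
    have hc : (C c : (X → ℂ)[X]).map (Germ.coeRingHom l) = C (c : Germ _ ℂ) := map_C _
    have := hγ i
    rw [germPolynomial, germPolynomial, ← hc, ← Polynomial.map_mul, map_coeRingHom_eq_iff] at this
    filter_upwards [this] with x hx
    rw [Polynomial.map_mul, familyPolynomial_map_eval, familyPolynomial_map_eval, map_C] at hx
    rw [hx, pairPolynomial_smul, Pi.evalRingHom_apply]
  filter_upwards [h 0, h 1] with x h₀ h₁
  exact pairPolynomial_injective (funext (Fin.forall_fin_two.2 ⟨h₀, h₁⟩))

end Family

section Specialization

variable {X : Type*} {U : Ultrafilter X} {z₀ : (Fin (N + 1) → ℂ) × (Fin (N + 1) → ℂ)}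
  {z y : X → (Fin (N + 1) → ℂ) × (Fin (N + 1) → ℂ)}

theorem germPolynomial_coeff_zero_ne_zero (hw : ∀ n, w n ≠ 0) (hαN : α ≤ N)
    (hz₀ : pairPolynomial z₀ = basePoint α (windowRatio α w 0))
    (hU : ∀ F, evalRealCoords z₀ F ≠ 0 → ∀ᶠ x in U, evalRealCoords (z x) F ≠ 0) (i : Fin 2) :
    (germPolynomial z U i).coeff 0 ≠ 0 := by
  rw [← pairPolynomial_coordinatePair_I_map_germRealCoords, coeff_map]
  refine germRealCoords_ne_zero (hU _ ?_)
  rw [← RingHom.coe_coe, ← coeff_map, pairPolynomial_coordinatePair_I_map, hz₀]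
  exact coeff_zero_basePoint_ne_zero α (windowRatio_zero_ne_zero hw hαN) i

theorem exists_germPolynomial_eq_C_mul (hα : 1 ≤ α) (hαN : α ≤ N) (hw : ∀ n, w n ≠ 0)
    (hz₀ : pairPolynomial z₀ = basePoint α (windowRatio α w 0))
    (hU : ∀ F, evalRealCoords z₀ F ≠ 0 → ∀ᶠ x in U, evalRealCoords (z x) F ≠ 0)
    (hyZ : ∀ᶠ x in U, y x ∈ linearRelations α w)
    (hy₀ : ∀ᶠ x in U, fourierIntensity (z x).1 = fourierIntensity (y x).1)
    (hy₁ : ∀ᶠ x in U, fourierIntensity (z x).2 = fourierIntensity (y x).2) (i : Fin 2) :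
    ∃ γ, germPolynomial y U i = C γ * germPolynomial z U i := by
  have hr := windowRatio_zero_ne_zero hw hαN
  simp only [← pairPolynomial_coordinatePair_I_map_germRealCoords (z := z)]
  refine exists_eq_C_mul_map_of_map_eq_basePoint (evalRealCoords z₀) (germRealCoords z U)
    (fun F hF => germRealCoords_ne_zero (hU F hF)) hα hαN (r := windowRatio α w)
    (s := fun j => conj (windowRatio α w j)) hr ((_root_.map_ne_zero _).2 hr)
    (Q := pairPolynomial (coordinatePair (-Complex.I))) (fun j => ?_) (fun j => ?_)
    (natDegree_pairPolynomial_le _) (q := germPolynomial (star y) U)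
    natDegree_germPolynomial_le natDegree_germPolynomial_le (fun j => ?_) ?_ ?_ i
  · rw [pairPolynomial_coordinatePair_I_map, hz₀]
  · rw [pairPolynomial_coordinatePair_neg_I_map, pairPolynomial_star, hz₀, basePoint_map]
  · rw [Polynomial.map_mul, ← reflect_map, pairPolynomial_coordinatePair_I_map_germRealCoords,
      pairPolynomial_coordinatePair_neg_I_map_germRealCoords]
    exact germPolynomial_mul_reflect_eq hy₀ hy₁ j
  · rw [germRealCoords_comp_algebraMap]
    exact isLinked_germPolynomial hw hyZ
  · rw [germRealCoords_comp_algebraMap]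
    exact isLinked_germPolynomial_star hw hyZ

theorem exists_eventually_eq_smul (hα : 1 ≤ α) (hαN : α ≤ N) (hw : ∀ n, w n ≠ 0)
    (hz₀ : pairPolynomial z₀ = basePoint α (windowRatio α w 0))
    (hU : ∀ F, evalRealCoords z₀ F ≠ 0 → ∀ᶠ x in U, evalRealCoords (z x) F ≠ 0)
    (hZ : ∀ᶠ x in U, z x ∈ linearRelations α w) (hyZ : ∀ᶠ x in U, y x ∈ linearRelations α w)
    (hy₀ : ∀ᶠ x in U, fourierIntensity (z x).1 = fourierIntensity (y x).1)
    (hy₁ : ∀ᶠ x in U, fourierIntensity (z x).2 = fourierIntensity (y x).2) :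
    ∃ c : X → ℂ, ∀ᶠ x in U, y x = c x • z x := by
  have hr : ((windowRatio α w 0 : ℂ) : Germ (U : Filter X) ℂ) ≠ 0 :=
    Germ.const_inj.not.2 (windowRatio_zero_ne_zero hw hαN)
  obtain ⟨γ, hγ⟩ := (isLinked_germPolynomial hw hZ).exists_common_scalar hαN
    (isLinked_germPolynomial hw hyZ) hr
    (germPolynomial_coeff_zero_ne_zero hw hαN hz₀ hU 0)
    (exists_germPolynomial_eq_C_mul hα hαN hw hz₀ hU hyZ hy₀ hy₁)
  exact exists_eventually_eq_smul_of_germ hγ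

end Specialization

end Reconstruction

end PhaselessSTFT

open PhaselessSTFT

theorem mainTheorem3 (W α : ℕ) (hα : 1 ≤ α) (hαW : α < W)
    (w : Fin W → ℂ) (hw : ∀ n, w n ≠ 0) :
    PhaselessSTFT.GenericOn (PhaselessSTFT.linearRelations α w) (fun y =>
      ∀ y' ∈ PhaselessSTFT.linearRelations α w,
        PhaselessSTFT.fourierIntensity y.1 = PhaselessSTFT.fourierIntensity y'.1 →
        PhaselessSTFT.fourierIntensity y.2 = PhaselessSTFT.fourierIntensity y'.2 →
        ∃ θ : ℝ, y' = Complex.exp (θ * Complex.I) • y) := by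
  obtain ⟨N, rfl⟩ : ∃ N, W = N + 1 := ⟨W - 1, by omega⟩
  have hαN : α ≤ N := by omega
  by_contra hgen
  obtain ⟨z₀, hz₀Z, hz₀⟩ := exists_mem_linearRelations_pairPolynomial_eq_basePoint hαN hw
  obtain ⟨U, hUB, hU⟩ := exists_ultrafilter_of_not_genericOn hgen hz₀Z
  have hbad : ∀ᶠ z in U, ∃ y ∈ linearRelations α w,
      fourierIntensity z.1 = fourierIntensity y.1 ∧ fourierIntensity z.2 = fourierIntensity y.2 ∧
        ¬ ∃ θ : ℝ, y = Complex.exp (θ * Complex.I) • z := by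
    filter_upwards [hUB] with z hz
    simpa only [not_forall, exists_prop] using hz.2
  obtain ⟨y, hy⟩ := hbad.choice
  obtain ⟨c, hc⟩ := exists_eventually_eq_smul (z := id) hα hαN hw hz₀ hU (hUB.mono fun z hz => hz.1)
    (hy.mono fun z hz => hz.1) (hy.mono fun z hz => hz.2.1) (hy.mono fun z hz => hz.2.2.1)
  obtain ⟨z, ⟨-, h₀, h₁, hphase⟩, hcz⟩ := (hy.and hc).exists
  exact hphase (exists_phase_of_fourierIntensity_eq hcz h₀ h₁)
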